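/- Let $G$ be a countable group with lower central series $G=G^0\supseteq G^1\supseteq\cdots$, $G^{k+1}=[G^k,G]$, and suppose that $\bigcap_{k\ge 0}G^k=\{1\}$. A left ordering of a group is a strict total order $<$ on it such that $a<b$ implies $ca<cb$; a bi-ordering is a left ordering for which also $a<b$ implies $ac<bc$. The set $LO(G)$ of left orderings of $G$ carries the smallest topology for which all sets $U_{a,b}=\{<\;:\;a<b\}$, $a,b\in G$, are open, and the set $BiO(G)\subseteq LO(G)$ of bi-orderings carries the subspace topology. A bi-ordering of $G$ is called standard if there are orderings $<_k$ of the (abelian) groups $G^k/G^{k+1}$, $k\ge 0$, such that, for every $k$ and every $g\in G^k\setminus G^{k+1}$, one has $1<g$ if and only if $1<_k gG^{k+1}$. Let $SBiO(G)\subseteq BiO(G)$ be the set of standard bi-orderings, with the subspace topology. (1) $SBiO(G)$ is a closed subset of $BiO(G)$. (2) If $G$ is non-trivial and not isomorphic to $\mathbb Z$, and each factor $G^k/G^{k+1}$ is finitely generated, then $SBiO(G)$ is either empty or homeomorphic to the Cantor set. -/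

import Mathlib

/-- A left ordering of `G`: a strict total order `<` such that `a < b` implies `c a < c b`. -/
@[ext]
structure LeftOrdering (G : Type*) [Mul G] where
  lt : G → G → Prop
  irrefl : ∀ a, ¬ lt a a
  trans : ∀ a b c, lt a b → lt b c → lt a c
  total : ∀ a b, lt a b ∨ a = b ∨ lt b a
  mul_left : ∀ a b c, lt a b → lt (c * a) (c * b)

namespace LeftOrdering

/-- The set `U_{a,b}` of the left orderings for which `a < b`. -/
def U {G : Type*} [Mul G] (a b : G) : Set (LeftOrdering G) := {o | o.lt a b}

/-- The smallest topology on the set of left orderings for which all the sets `U_{a,b}` are open. -/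
instance {G : Type*} [Mul G] : TopologicalSpace (LeftOrdering G) :=
  TopologicalSpace.generateFrom {s | ∃ a b : G, s = U a b}

end LeftOrdering

/-- The set of bi-orderings: the left orderings that are also right orderings.
Its topology is the subspace topology. -/
def BiO (G : Type*) [Mul G] : Set (LeftOrdering G) :=
  {o | ∀ a b c : G, o.lt a b → o.lt (a * c) (b * c)}

/-- The factor `G^k / G^{k+1}` of the lower central series `G = G^0 ⊇ G^1 ⊇ ...`. -/
abbrev LCSFactor (G : Type*) [Group G] (k : ℕ) : Type _ :=
  (Subgroup.lowerCentralSeries (⊤ : Subgroup G) k) ⧸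
    (Subgroup.lowerCentralSeries (⊤ : Subgroup G) (k + 1)).subgroupOf
      (Subgroup.lowerCentralSeries (⊤ : Subgroup G) k)

/-- The set of standard bi-orderings of `G`: those induced by some choice of orderings of the
factors `G^k / G^{k+1}`, an element `g` of `G^k` outside `G^{k+1}` being positive if and only if
its class in `G^k / G^{k+1}` is positive.  (The factors are abelian, so left orderings of them
are the same as bi-orderings.) -/
def SBiO (G : Type*) [Group G] : Set (BiO G) :=
  {o | ∃ f : ∀ k : ℕ, LeftOrdering (LCSFactor G k),
    ∀ (k : ℕ) (g : Subgroup.lowerCentralSeries (⊤ : Subgroup G) k),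
      (g : G) ∉ Subgroup.lowerCentralSeries (⊤ : Subgroup G) (k + 1) →
        (o.1.lt 1 (g : G) ↔ (f k).lt 1 (QuotientGroup.mk g))}

/-! Closedness: by `mem_SBiO_iff`, a bi-ordering is standard exactly when `1 < g` forces `1 < g * h`
for all `g` in G^k outside G^{k+1} and `h` in G^{k+1}. Each such condition cuts out a clopen set, so
their intersection is closed.

Cantor set: LO(G) is compact, hence so is SBiO(G), and the countably many clopen sets U_{1,g}
separate its points. By `nonempty_homeomorph_nat_bool` it remains to exclude isolated points. Given
a standard bi-ordering and finitely many positive elements, only the ordering of the abelianization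
G/G^1 is replaced, lexicographically, by a different one that keeps the nontrivial images of those
elements positive (`exists_ne_mem_SBiO`).

Such a replacement exists unless G/G^1 is cyclic (`isCyclic_of_isolated`): if finitely many positive
elements determine an ordering of an abelian group, every positive element has a power in the monoid
they generate; discarding generators one by one leaves a group of rank at most one. If G/G^1 is
cyclic, so is G by residual nilpotence, and an ordered nontrivial cyclic group is isomorphic to ℤ.
-/

/-! ### Brouwer's characterization of the Cantor space. -/

section CantorSpace

variable {X : Type*}

/-- The cell of level `n` of the binary splitting scheme `D` that contains `x`. -/
def splitCell (D : ℕ → Set X → Set X) (x : X) : ℕ → Set X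
  | 0 => Set.univ
  | n + 1 => {y ∈ splitCell D x n | y ∈ D n (splitCell D x n) ↔ x ∈ D n (splitCell D x n)}

/-- The cell of level `n` of the binary splitting scheme `D` along the branch `s`. -/
def branchCell (D : ℕ → Set X → Set X) (s : ℕ → Bool) : ℕ → Set X
  | 0 => Set.univ
  | n + 1 => {y ∈ branchCell D s n | y ∈ D n (branchCell D s n) ↔ s n = true}

theorem mem_splitCell (D : ℕ → Set X → Set X) (x : X) (n : ℕ) : x ∈ splitCell D x n := by
  induction n with
  | zero => trivial
  | succ n ih => exact ⟨ih, Iff.rfl⟩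

theorem splitCell_eq_of_mem (D : ℕ → Set X → Set X) {x y : X} {n : ℕ}
    (h : y ∈ splitCell D x n) : splitCell D y n = splitCell D x n := by
  induction n with
  | zero => rfl
  | succ n ih =>
    obtain ⟨h₁, h₂⟩ := h
    simp only [splitCell, ih h₁, h₂]

theorem isClopen_sep_mem_iff [TopologicalSpace X] {A B : Set X} (hA : IsClopen A)
    (hB : IsClopen B) (p : Prop) : IsClopen {y ∈ A | y ∈ B ↔ p} := by
  by_cases hp : p
  · simp only [hp, iff_true]
    exact hA.inter hB
  · simp only [hp, iff_false]
    exact hA.inter hB.compl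

/-- A nonempty compact space without isolated points in which countably many clopen sets separate
the points is homeomorphic to the Cantor space. -/
theorem nonempty_homeomorph_nat_bool [TopologicalSpace X] [CompactSpace X] [Nonempty X]
    (C : ℕ → Set X) (hC : ∀ n, IsClopen (C n))
    (hsep : ∀ x y, (∀ n, x ∈ C n ↔ y ∈ C n) → x = y)
    (hperf : ∀ V : Set X, IsOpen V → V.Nonempty → V.Nontrivial) :
    Nonempty (X ≃ₜ (ℕ → Bool)) := by
  classical
  have key : ∀ (n : ℕ) (A : Set X), ∃ D : Set X, IsClopen D ∧ (IsOpen A → A.Nonempty →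
      (A ∩ D).Nonempty ∧ (A \ D).Nonempty ∧
        ∀ x ∈ A, ∀ y ∈ A, (x ∈ D ↔ y ∈ D) → (x ∈ C n ↔ y ∈ C n)) := by
    intro n A
    -- If `C n` does not cut `A`, membership in `C n` is constant on `A`, so any `C m` separating
    -- two points of `A` can be used instead.
    by_cases h : (A ∩ C n).Nonempty ∧ (A \ C n).Nonempty
    · exact ⟨C n, hC n, fun _ _ => ⟨h.1, h.2, fun _ _ _ _ h => h⟩⟩
    by_cases hA : IsOpen A ∧ A.Nonempty
    · obtain ⟨x, hx, y, hy, hxy⟩ := hperf A hA.1 hA.2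
      obtain ⟨m, hm⟩ : ∃ m, ¬ (x ∈ C m ↔ y ∈ C m) := by
        by_contra! hcon
        exact hxy (hsep x y hcon)
      refine ⟨C m, hC m, fun _ _ => ?_⟩
      have hdec : ∀ x ∈ A, ∀ y ∈ A, x ∈ C n → y ∈ C n := fun x hx y hy hxn => by
        by_contra hyn
        exact h ⟨⟨x, hx, hxn⟩, ⟨y, hy, hyn⟩⟩
      refine ⟨?_, ?_, fun x hx y hy _ => ⟨hdec x hx y hy, hdec y hy x hx⟩⟩
      · by_cases hxm : x ∈ C m
        · exact ⟨x, hx, hxm⟩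
        · exact ⟨y, hy, by tauto⟩
      · by_cases hxm : x ∈ C m
        · exact ⟨y, hy, by tauto⟩
        · exact ⟨x, hx, hxm⟩
    · exact ⟨∅, isClopen_empty, fun h₁ h₂ => absurd ⟨h₁, h₂⟩ hA⟩
  choose D hD hsplit using key
  have hE : ∀ x n, IsClopen (splitCell D x n) := by
    intro x n
    induction n with
    | zero => exact isClopen_univ
    | succ n ih => exact isClopen_sep_mem_iff ih (hD _ _) _
  have hB : ∀ s n, IsClopen (branchCell D s n) := by
    intro x n
    induction n with
    | zero => exact isClopen_univ
    | succ n ih => exact isClopen_sep_mem_iff ih (hD _ _) _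
  have hBne : ∀ s n, (branchCell D s n).Nonempty := by
    intro s n
    induction n with
    | zero => exact Set.univ_nonempty
    | succ n ih =>
      obtain ⟨⟨x, hx, hx'⟩, ⟨y, hy, hy'⟩, -⟩ := hsplit n _ (hB s n).isOpen ih
      cases hs : s n
      · exact ⟨y, hy, by simp [hy', hs]⟩
      · exact ⟨x, hx, by simp [hx', hs]⟩
  let f : X → ℕ → Bool := fun x n => decide (x ∈ D n (splitCell D x n))
  have hf : Continuous f := by
    refine continuous_pi fun n => IsLocallyConstant.continuous
      ((IsLocallyConstant.iff_exists_open _).2 fun x =>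
        ⟨splitCell D x (n + 1), (hE x (n + 1)).isOpen, mem_splitCell D x _, fun y hy => ?_⟩)
    simp only [f, splitCell_eq_of_mem D hy.1, hy.2]
  have hinj : Function.Injective f := by
    intro x y hxy
    have hcell : ∀ n, splitCell D x n = splitCell D y n := by
      intro n
      induction n with
      | zero => rfl
      | succ n ih =>
        have h := congrFun hxy n
        simp only [f, decide_eq_decide, ih] at h
        simp only [splitCell, ih, h]
    -- Points with the same branch share every cell, and the n-th split decides membership in `C n`
    -- within the cell.
    refine hsep x y fun n => ?_
    have h := congrFun hxy n
    simp only [f, decide_eq_decide, hcell n] at h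
    exact (hsplit n _ (hE y n).isOpen ⟨y, mem_splitCell D y n⟩).2.2 x
      (hcell n ▸ mem_splitCell D x n) y (mem_splitCell D y n) h
  have hsurj : Function.Surjective f := by
    intro s
    -- The cells along `s` are nested, nonempty and compact, so some point lies in all of them.
    obtain ⟨x, hx⟩ := IsCompact.nonempty_iInter_of_sequence_nonempty_isCompact_isClosed
      (branchCell D s) (fun n y hy => hy.1) (hBne s) (hB s 0).isClosed.isCompact
      (fun n => (hB s n).isClosed)
    rw [Set.mem_iInter] at hx
    have hcell : ∀ n, splitCell D x n = branchCell D s n := by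
      intro n
      induction n with
      | zero => rfl
      | succ n ih => simp only [splitCell, branchCell, ih, (hx (n + 1)).2]
    refine ⟨x, funext fun n => ?_⟩
    simp only [f, hcell n, (hx (n + 1)).2, Bool.decide_eq_true]
  exact ⟨Continuous.homeoOfEquivCompactToT2 (f := Equiv.ofBijective f ⟨hinj, hsurj⟩) hf⟩

end CantorSpace

namespace LeftOrdering

/-! ### Positive cones and compactness of the space of left orderings. -/

section Group

variable {G : Type*} [Group G]

theorem lt_iff_one_lt (o : LeftOrdering G) (a b : G) : o.lt a b ↔ o.lt 1 (a⁻¹ * b) := by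
  refine ⟨fun h => ?_, fun h => ?_⟩
  · simpa using o.mul_left _ _ a⁻¹ h
  · simpa using o.mul_left _ _ a h

theorem asymm (o : LeftOrdering G) {a b : G} (h : o.lt a b) : ¬ o.lt b a :=
  fun h' => o.irrefl a (o.trans _ _ _ h h')

theorem one_lt_or_one_lt_inv (o : LeftOrdering G) {a : G} (ha : a ≠ 1) :
    o.lt 1 a ∨ o.lt 1 a⁻¹ := by
  rcases o.total 1 a with h | h | h
  · exact .inl h
  · exact absurd h.symm ha
  · exact .inr (by simpa using (o.lt_iff_one_lt a 1).1 h)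

theorem not_one_lt_inv (o : LeftOrdering G) {a : G} (h : o.lt 1 a) : ¬ o.lt 1 a⁻¹ := fun h' =>
  o.asymm h ((o.lt_iff_one_lt a 1).2 (by simpa using h'))

theorem one_lt_mul (o : LeftOrdering G) {a b : G} (ha : o.lt 1 a) (hb : o.lt 1 b) :
    o.lt 1 (a * b) :=
  o.trans _ _ _ ha (by simpa using o.mul_left _ _ a hb)

theorem ext_one_lt {o o' : LeftOrdering G} (h : ∀ a, o.lt 1 a ↔ o'.lt 1 a) : o = o' := by
  ext a b
  rw [o.lt_iff_one_lt, o'.lt_iff_one_lt, h]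

/-- The left ordering with a given positive cone. -/
def ofCone (P : G → Prop) (h1 : ¬ P 1) (hmul : ∀ a b, P a → P b → P (a * b))
    (htot : ∀ a, a ≠ 1 → P a ∨ P a⁻¹) : LeftOrdering G where
  lt a b := P (a⁻¹ * b)
  irrefl a := by simpa using h1
  trans a b c hab hbc := by simpa [mul_assoc] using hmul _ _ hab hbc
  total a b := by
    by_cases hab : a = b
    · exact .inr (.inl hab)
    · rcases htot (a⁻¹ * b) (fun h => hab (inv_mul_eq_one.1 h)) with h | h
      · exact .inl h
      · exact .inr (.inr (by simpa using h))
  mul_left a b c h := by simpa [mul_assoc] using h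

theorem ofCone_one_lt {P : G → Prop} {h1 hmul htot} (a : G) :
    (ofCone (G := G) P h1 hmul htot).lt 1 a ↔ P a := by
  simp [ofCone]

theorem one_lt_pow (o : LeftOrdering G) {a : G} (ha : o.lt 1 a) {n : ℕ} (hn : n ≠ 0) :
    o.lt 1 (a ^ n) := by
  induction n with
  | zero => exact absurd rfl hn
  | succ n ih =>
    rcases eq_or_ne n 0 with rfl | h
    · simpa using ha
    · rw [pow_succ]
      exact o.one_lt_mul (ih h) ha

theorem eq_one_of_pow_eq_one (o : LeftOrdering G) {a : G} {n : ℕ} (hn : n ≠ 0)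
    (h : a ^ n = 1) : a = 1 := by
  by_contra ha
  rcases o.one_lt_or_one_lt_inv ha with h' | h'
  · exact o.irrefl 1 (by simpa [h] using o.one_lt_pow h' hn)
  · exact o.irrefl 1 (by simpa [h] using o.one_lt_pow h' hn)

theorem isOpen_U (a b : G) : IsOpen (U a b) :=
  TopologicalSpace.isOpen_generateFrom_of_mem ⟨a, b, rfl⟩

theorem isClopen_U (a b : G) : IsClopen (U a b) := by
  refine ⟨⟨?_⟩, isOpen_U a b⟩
  by_cases hab : a = b
  · convert isOpen_univ
    rw [Set.eq_univ_iff_forall]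
    rintro o (h : o.lt a b)
    exact o.irrefl b (hab ▸ h)
  · convert isOpen_U b a
    ext o
    refine ⟨fun h => ?_, fun h h' => o.asymm h h'⟩
    rcases o.total a b with h' | h' | h'
    · exact absurd h' h
    · exact absurd h' hab
    · exact h'

/-- An ultrafilter of orderings converges to its majority ordering: `a < b` when this holds for
almost all members. -/
instance : CompactSpace (LeftOrdering G) := by
  refine ⟨isCompact_iff_ultrafilter_le_nhds.2 fun F _ => ?_⟩
  refine ⟨⟨fun a b => U a b ∈ F, fun a h => ?_, fun a b c hab hbc => ?_, fun a b => ?_,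
    fun a b c hab => ?_⟩, trivial, ?_⟩
  · obtain ⟨o, ho⟩ := F.nonempty_of_mem h
    exact o.irrefl a ho
  · filter_upwards [hab, hbc] with o h₁ h₂ using o.trans _ _ _ h₁ h₂
  · by_cases hab : a = b
    · exact .inr (.inl hab)
    have h : U a b ∪ U b a ∈ F := by
      filter_upwards with o
      rcases o.total a b with h | h | h
      · exact .inl h
      · exact absurd h hab
      · exact .inr h
    rcases Ultrafilter.union_mem_iff.1 h with h | h
    · exact .inl h
    · exact .inr (.inr h)
  · filter_upwards [hab] with o h using o.mul_left _ _ _ h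
  · rw [TopologicalSpace.nhds_generateFrom]
    simp only [le_iInf_iff, Filter.le_principal_iff]
    rintro s ⟨hs, a, b, rfl⟩
    exact hs

end Group

/-! ### Orderings of abelian groups isolated by finitely many inequalities. -/

section CommGroup

variable {Q : Type*} [CommGroup Q]

theorem mem_closure_insert_iff {a x : Q} {S : Set Q} :
    x ∈ Submonoid.closure (insert a S) ↔ ∃ n : ℕ, ∃ s ∈ Submonoid.closure S, x = a ^ n * s := by
  rw [Set.insert_eq, Submonoid.closure_union, Submonoid.mem_sup]
  simp only [Submonoid.mem_closure_singleton]
  constructor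
  · rintro ⟨_, ⟨n, rfl⟩, s, hs, rfl⟩
    exact ⟨n, s, hs, rfl⟩
  · rintro ⟨n, s, hs, rfl⟩
    exact ⟨_, ⟨n, rfl⟩, s, hs, rfl⟩

theorem eq_one_or_one_lt_of_mem_closure (o : LeftOrdering Q) {S : Set Q}
    (hS : ∀ x ∈ S, o.lt 1 x) {x : Q} (hx : x ∈ Submonoid.closure S) : x = 1 ∨ o.lt 1 x := by
  induction hx using Submonoid.closure_induction with
  | mem x hx => exact .inr (hS x hx)
  | one => exact .inl rfl
  | mul x y _ _ hx hy =>
    rcases hx with rfl | hx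
    · simpa using hy
    rcases hy with rfl | hy
    · exact .inr (by simpa using hx)
    · exact .inr (o.one_lt_mul hx hy)

/-- In a torsion-free abelian group a pointed submonoid is contained in the nonnegative cone of
some ordering. -/
theorem exists_of_pointed (htf : ∀ (a : Q) (n : ℕ), n ≠ 0 → a ^ n = 1 → a = 1)
    (M : Submonoid Q) (hM : ∀ x ∈ M, x⁻¹ ∈ M → x = 1) :
    ∃ o : LeftOrdering Q, ∀ x ∈ M, x ≠ 1 → o.lt 1 x := by
  obtain ⟨N, hMN, hN⟩ := zorn_le_nonempty₀ {N : Submonoid Q | ∀ x ∈ N, x⁻¹ ∈ N → x = 1} (by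
    intro c hc hchain y hy
    refine ⟨sSup c, fun x hx hx' => ?_, fun z hz => le_sSup hz⟩
    rw [Submonoid.mem_sSup_of_directedOn ⟨y, hy⟩ hchain.directedOn] at hx hx'
    obtain ⟨K, hK, hxK⟩ := hx
    obtain ⟨L, hL, hxL⟩ := hx'
    rcases hchain.total hK hL with h | h
    · exact hc hL x (h hxK) hxL
    · exact hc hK x hxK (h hxL)) M hM
  have hpt : ∀ x ∈ N, x⁻¹ ∈ N → x = 1 := hN.prop
  -- By maximality, adjoining `a` to `N` destroys pointedness. A relation (a^n s)(a^m t) = 1 puts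
  -- the inverse of a^(n+m) in `N`, and if n + m = 0 it is already a relation in `N`.
  have hext : ∀ a, a ∉ N → ∃ n : ℕ, n ≠ 0 ∧ (a ^ n)⁻¹ ∈ N := by
    intro a ha
    by_contra! hcon
    refine ha (hN.le_of_ge (y := Submonoid.closure (insert a N)) ?_ ?_
      (Submonoid.subset_closure (Set.mem_insert _ _)))
    · intro x hx hx'
      obtain ⟨n, s, hs, rfl⟩ := mem_closure_insert_iff.1 hx
      obtain ⟨m, t, ht, hm⟩ := mem_closure_insert_iff.1 hx'
      rw [Submonoid.closure_eq] at hs ht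
      have hst : (a ^ (n + m))⁻¹ = s * t := by
        rw [inv_eq_iff_mul_eq_one, pow_add,
          show a ^ n * a ^ m * (s * t) = (a ^ n * s) * (a ^ m * t) by
            simp only [mul_assoc, mul_left_comm], ← hm, mul_inv_cancel]
      have hnm : n + m = 0 := by
        by_contra h
        exact hcon _ h (hst ▸ N.mul_mem hs ht)
      obtain ⟨rfl, rfl⟩ : n = 0 ∧ m = 0 := by omega
      simp only [pow_zero, one_mul] at hm ⊢
      exact hpt s hs (hm ▸ ht)
    · exact fun x hx => Submonoid.subset_closure (Set.mem_insert_of_mem _ hx)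
  -- If both fail, a common power of `a` lies in `N` with its inverse, hence is trivial, and
  -- torsion-freeness gives a = 1.
  have htot : ∀ a, a ∈ N ∨ a⁻¹ ∈ N := by
    intro a
    by_contra! h
    obtain ⟨n, hn, hna⟩ := hext a h.1
    obtain ⟨m, hm, hma⟩ := hext a⁻¹ h.2
    have h1 : (a ^ (n * m))⁻¹ ∈ N := by
      rw [pow_mul, ← inv_pow]
      exact N.pow_mem hna m
    have h2 : (a ^ (n * m)) ∈ N := by
      rw [inv_pow, inv_inv] at hma
      rw [mul_comm, pow_mul]
      exact N.pow_mem hma n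
    exact h.1 (htf a _ (Nat.mul_ne_zero hn hm) (hpt _ h2 h1) ▸ N.one_mem)
  refine ⟨ofCone (fun x => x ∈ N ∧ x ≠ 1) (fun h => h.2 rfl) ?_ ?_, fun x hx hx1 =>
    (ofCone_one_lt x).2 ⟨hMN hx, hx1⟩⟩
  · rintro a b ⟨ha, ha1⟩ ⟨hb, -⟩
    refine ⟨N.mul_mem ha hb, fun h => ha1 (hpt a ha ?_)⟩
    rwa [inv_eq_of_mul_eq_one_right h]
  · intro a ha
    rcases htot a with h | h
    · exact .inl ⟨h, ha⟩
    · exact .inr ⟨h, by simpa using ha⟩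

/-- If finitely many positive elements determine an ordering of an abelian group, then every
positive element has a power in the submonoid that they generate. -/
theorem exists_pow_mem_closure (o : LeftOrdering Q) {S : Set Q} (hS : ∀ x ∈ S, o.lt 1 x)
    (huniq : ∀ o' : LeftOrdering Q, (∀ x ∈ S, o'.lt 1 x) → o' = o) {a : Q} (ha : o.lt 1 a) :
    ∃ n : ℕ, n ≠ 0 ∧ a ^ n ∈ Submonoid.closure S := by
  by_contra! hcon
  -- If no power of `a` lies in the monoid generated by `S`, adjoining `a⁻¹` keeps it pointed, which
  -- yields a second ordering positive on `S`.
  obtain ⟨o', ho'⟩ := exists_of_pointed (fun a n => o.eq_one_of_pow_eq_one)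
    (Submonoid.closure (insert a⁻¹ S)) (by
      intro x hx hx'
      obtain ⟨n, s, hs, rfl⟩ := mem_closure_insert_iff.1 hx
      obtain ⟨m, t, ht, hm⟩ := mem_closure_insert_iff.1 hx'
      have hst : a ^ (n + m) = s * t := by
        rw [← inv_inv (a ^ (n + m)), inv_eq_iff_mul_eq_one, ← inv_pow, pow_add,
          show a⁻¹ ^ n * a⁻¹ ^ m * (s * t) = (a⁻¹ ^ n * s) * (a⁻¹ ^ m * t) by
            simp only [mul_assoc, mul_left_comm], ← hm, mul_inv_cancel]
      have hnm : n + m = 0 := by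
        by_contra h
        exact hcon _ h (hst ▸ Submonoid.mul_mem _ hs ht)
      obtain ⟨rfl, rfl⟩ : n = 0 ∧ m = 0 := by omega
      simp only [pow_zero, one_mul] at hm ⊢
      rcases o.eq_one_or_one_lt_of_mem_closure hS hs with h | h
      · exact h
      rcases o.eq_one_or_one_lt_of_mem_closure hS ht with h' | h'
      · simpa [h'] using hm
      · exact absurd (hm ▸ h') (o.not_one_lt_inv h))
  have ha1 : a ≠ 1 := fun h => o.irrefl 1 (h ▸ ha)
  have := huniq o' fun x hx => ho' x
    (Submonoid.subset_closure (Set.mem_insert_of_mem _ hx)) fun h => o.irrefl 1 (h ▸ hS x hx)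
  subst this
  exact o'.not_one_lt_inv ha
    (ho' _ (Submonoid.subset_closure (Set.mem_insert _ _)) (by simpa using ha1))

/-- If every positive element has a power in the submonoid generated by a finite set of positive
elements, then a single element will do. -/
theorem exists_forall_pow_eq_pow (o : LeftOrdering Q) (S : Finset Q) (hS : ∀ x ∈ S, o.lt 1 x)
    (hgen : ∀ a, o.lt 1 a → ∃ n : ℕ, n ≠ 0 ∧ a ^ n ∈ Submonoid.closure (S : Set Q)) :
    ∃ f : Q, ∀ a, o.lt 1 a → ∃ n : ℕ, n ≠ 0 ∧ ∃ k : ℕ, a ^ n = f ^ k := by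
  classical
  induction hc : S.card using Nat.strong_induction_on generalizing S with
  | _ c ih =>
  by_cases hsub : ∃ x ∈ S, ∃ y ∈ S, o.lt y x
  · obtain ⟨x, hx, y, hy, hyx⟩ := hsub
    set T := S.erase x with hT
    have hyT : y ∈ T := Finset.mem_erase.2 ⟨fun h => o.irrefl x (h ▸ hyx), hy⟩
    have hins : (S : Set Q) = insert x (T : Set Q) := by
      rw [← Finset.coe_insert, hT, Finset.insert_erase hx]
    have hST : ∀ z ∈ T, o.lt 1 z := fun z hz => hS z (Finset.mem_of_mem_erase hz)
    obtain ⟨n, hn, hmem⟩ := hgen _ ((o.lt_iff_one_lt y x).1 hyx)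
    rw [hins] at hmem
    obtain ⟨m, s, hs, hms⟩ := mem_closure_insert_iff.1 hmem
    have hxn : x ^ n = x ^ m * (y ^ n * s) := by
      rw [mul_left_comm, ← hms, ← mul_pow, mul_inv_cancel_left]
    have hmn : m < n := by
      by_contra! hle
      obtain ⟨d, rfl⟩ := Nat.exists_eq_add_of_le hle
      rw [pow_add, mul_assoc, left_eq_mul] at hxn
      have hpos : o.lt 1 (y ^ n) := o.one_lt_pow (hS y hy) hn
      have hrest : x ^ d * s ∈ Submonoid.closure (S : Set Q) := by
        rw [hins]
        exact mem_closure_insert_iff.2 ⟨d, s, hs, rfl⟩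
      have hinv : (y ^ n)⁻¹ = x ^ d * s := by
        rw [inv_eq_iff_mul_eq_one, mul_left_comm, hxn]
      rcases o.eq_one_or_one_lt_of_mem_closure hS hrest with h | h
      · rw [← hinv, inv_eq_one] at h
        exact o.irrefl 1 (h ▸ hpos)
      · exact o.not_one_lt_inv hpos (hinv ▸ h)
    obtain ⟨d, rfl⟩ := Nat.exists_eq_add_of_lt hmn
    rw [add_assoc, pow_add, mul_right_inj] at hxn
    have hxd : x ^ (d + 1) ∈ Submonoid.closure (T : Set Q) := by
      rw [hxn]
      exact Submonoid.mul_mem _ (Submonoid.pow_mem _ (Submonoid.subset_closure hyT) _) hs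
    refine ih T.card (hc ▸ Finset.card_erase_lt_of_mem hx) T hST (fun a ha => ?_) rfl
    obtain ⟨j, hj, haj⟩ := hgen a ha
    rw [hins] at haj
    obtain ⟨i, t, ht, hit⟩ := mem_closure_insert_iff.1 haj
    refine ⟨j * (d + 1), Nat.mul_ne_zero hj d.succ_ne_zero, ?_⟩
    rw [pow_mul, hit, mul_pow, ← pow_mul, mul_comm i, pow_mul]
    exact Submonoid.mul_mem _ (Submonoid.pow_mem _ hxd _) (Submonoid.pow_mem _ ht _)
  · have hss : (S : Set Q).Subsingleton := fun x hx y hy => by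
      rcases o.total x y with h | h | h
      · exact absurd ⟨y, hy, x, hx, h⟩ hsub
      · exact h
      · exact absurd ⟨x, hx, y, hy, h⟩ hsub
    obtain ⟨f, hf⟩ : ∃ f, (S : Set Q) ⊆ {f} := by
      rcases hss.eq_empty_or_singleton with h | ⟨f, h⟩
      · exact ⟨1, h ▸ Set.empty_subset _⟩
      · exact ⟨f, h.subset⟩
    refine ⟨f, fun a ha => ?_⟩
    obtain ⟨n, hn, hmem⟩ := hgen a ha
    obtain ⟨k, hk⟩ := Submonoid.mem_closure_singleton.1 (Submonoid.closure_mono hf hmem)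
    exact ⟨n, hn, k, hk.symm⟩

/-- A finitely generated torsion-free abelian group of rank at most one is cyclic. -/
theorem isCyclic_of_forall_pow_eq_zpow [Group.FG Q]
    (htf : ∀ (a : Q) (n : ℕ), n ≠ 0 → a ^ n = 1 → a = 1) (f : Q)
    (hf : ∀ a : Q, ∃ n : ℕ, n ≠ 0 ∧ ∃ k : ℤ, a ^ n = f ^ k) : IsCyclic Q := by
  have : IsMulTorsionFree Q := ⟨fun n hn a b hab => by
    have h : (a / b) ^ n = 1 := by
      rw [div_pow, div_eq_one]
      exact hab
    exact div_eq_one.1 (htf _ n hn h)⟩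
  have : Module.Finite ℤ (Additive Q) := Module.Finite.iff_addGroup_fg.2 inferInstance
  obtain ⟨n, b⟩ := Module.basisOfFiniteTypeTorsionFree' (R := ℤ) (M := Additive Q)
  have hsub : Subsingleton (Fin n) := by
    refine ⟨fun i j => ?_⟩
    by_contra hij
    have hf' : ∀ a : Additive Q, ∃ n : ℕ, n ≠ 0 ∧ ∃ k : ℤ, n • a = k • Additive.ofMul f :=
      fun a => hf a.toMul
    -- Two distinct basis vectors cannot both have nonzero multiples on the line through `f`:
    -- comparing coordinates i and j forces k₁ = 0 or the j-th coordinate of `f` to vanish.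
    obtain ⟨n₁, hn₁, k₁, h₁⟩ := hf' (b i)
    obtain ⟨n₂, hn₂, k₂, h₂⟩ := hf' (b j)
    have e₁ := congrArg (fun x => b.repr x i) h₁
    have e₂ := congrArg (fun x => b.repr x j) h₁
    have e₃ := congrArg (fun x => b.repr x j) h₂
    simp [hij] at e₁ e₂ e₃
    rcases e₂ with h | h
    · simp [h, hn₁] at e₁
    · simp [h, hn₂] at e₃
  rcases n with _ | _ | n
  · refine ⟨1, fun x => ?_⟩
    have := b.sum_repr (Additive.ofMul x)
    simp at this
    exact ⟨0, (zpow_zero _).trans this⟩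
  · refine ⟨(b 0).toMul, fun x => ⟨b.repr (Additive.ofMul x) 0, ?_⟩⟩
    have := b.sum_repr (Additive.ofMul x)
    simp at this
    exact this
  · exact absurd (hsub.elim 0 1) (by simp)

/-- A finitely generated abelian group with an ordering determined by finitely many positive
elements is cyclic. -/
theorem isCyclic_of_isolated [Group.FG Q] (o : LeftOrdering Q) (S : Finset Q)
    (hS : ∀ x ∈ S, o.lt 1 x)
    (huniq : ∀ o' : LeftOrdering Q, (∀ x ∈ S, o'.lt 1 x) → o' = o) : IsCyclic Q := by
  obtain ⟨f, hf⟩ := o.exists_forall_pow_eq_pow S hS fun a ha =>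
    o.exists_pow_mem_closure hS huniq ha
  refine isCyclic_of_forall_pow_eq_zpow (fun a n => o.eq_one_of_pow_eq_one) f fun a => ?_
  rcases eq_or_ne a 1 with rfl | ha
  · exact ⟨1, one_ne_zero, 0, by simp⟩
  rcases o.one_lt_or_one_lt_inv ha with h | h
  · obtain ⟨n, hn, k, hk⟩ := hf a h
    exact ⟨n, hn, k, by simpa using hk⟩
  · obtain ⟨n, hn, k, hk⟩ := hf _ h
    exact ⟨n, hn, -k, by rw [zpow_neg, zpow_natCast, ← hk, inv_pow, inv_inv]⟩

end CommGroup

end LeftOrdering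

/-! ### Standard bi-orderings: sign criterion and closedness. -/

section Standard

open scoped commutatorElement

variable {G : Type*} [Group G]

/-- A bi-ordering is standard if and only if the sign of an element of `G^k` outside `G^{k+1}`
depends only on its class modulo `G^{k+1}`. -/
theorem mem_SBiO_iff (o : BiO G) : o ∈ SBiO G ↔
    ∀ k, ∀ g ∈ Subgroup.lowerCentralSeries (⊤ : Subgroup G) k,
      g ∉ Subgroup.lowerCentralSeries (⊤ : Subgroup G) (k + 1) →
      ∀ h ∈ Subgroup.lowerCentralSeries (⊤ : Subgroup G) (k + 1),
        o.1.lt 1 g → o.1.lt 1 (g * h) := by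
  constructor
  · rintro ⟨f, hf⟩ k g hg hg' h hh hpos
    have hhk := Subgroup.lowerCentralSeries_antitone (S := (⊤ : Subgroup G)) k.le_succ hh
    have hgh : g * h ∉ Subgroup.lowerCentralSeries (⊤ : Subgroup G) (k + 1) :=
      fun hmem => hg' ((Subgroup.mul_mem_cancel_right _ hh).1 hmem)
    rw [hf k ⟨g * h, Subgroup.mul_mem _ hg hhk⟩ hgh]
    rw [hf k ⟨g, hg⟩ hg'] at hpos
    convert hpos using 1
    refine (QuotientGroup.eq.2 ?_).symm
    simpa [Subgroup.mem_subgroupOf] using hh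
  · intro H
    have key : ∀ k, ∃ f : LeftOrdering (LCSFactor G k),
        ∀ g : Subgroup.lowerCentralSeries (⊤ : Subgroup G) k,
          (g : G) ∉ Subgroup.lowerCentralSeries (⊤ : Subgroup G) (k + 1) →
          (o.1.lt 1 (g : G) ↔ f.lt 1 (QuotientGroup.mk g)) := by
      intro k
      let P : LCSFactor G k → Prop := fun q =>
        ∃ g : Subgroup.lowerCentralSeries (⊤ : Subgroup G) k, QuotientGroup.mk g = q ∧
          (g : G) ∉ Subgroup.lowerCentralSeries (⊤ : Subgroup G) (k + 1) ∧ o.1.lt 1 (g : G)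
      have hone : ∀ g : Subgroup.lowerCentralSeries (⊤ : Subgroup G) k,
          (QuotientGroup.mk g : LCSFactor G k) = 1 ↔
            (g : G) ∈ Subgroup.lowerCentralSeries (⊤ : Subgroup G) (k + 1) := fun g => by
        rw [QuotientGroup.eq_one_iff, Subgroup.mem_subgroupOf]
      have hP : ∀ g : Subgroup.lowerCentralSeries (⊤ : Subgroup G) k,
          (g : G) ∉ Subgroup.lowerCentralSeries (⊤ : Subgroup G) (k + 1) →
          (P (QuotientGroup.mk g) ↔ o.1.lt 1 (g : G)) := by
        refine fun g hg => ⟨?_, fun h => ⟨g, rfl, hg, h⟩⟩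
        rintro ⟨g', hgg', hg', hpos⟩
        have hmem := QuotientGroup.eq.1 hgg'
        rw [Subgroup.mem_subgroupOf] at hmem
        simpa using H k g' g'.2 hg' _ hmem hpos
      refine ⟨LeftOrdering.ofCone P ?_ ?_ ?_, fun g hg => ?_⟩
      · rintro ⟨g, hg1, hg, -⟩
        exact hg ((hone g).1 hg1)
      · rintro _ _ ⟨a, rfl, ha, hapos⟩ ⟨b, rfl, hb, hbpos⟩
        refine ⟨a * b, rfl, fun hab => ?_, o.1.one_lt_mul hapos hbpos⟩
        -- If `a * b` were in G^{k+1}, then a⁻¹ = b (ab)⁻¹ would be positive along with `b`.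
        refine o.1.not_one_lt_inv hapos ?_
        have := H k b b.2 hb _ (Subgroup.inv_mem _ hab) hbpos
        simpa using this
      · intro q
        induction q using QuotientGroup.induction_on with
        | H g =>
          intro hg
          have hg' := fun h => hg ((hone g).2 h)
          have hginv : ((g⁻¹ : Subgroup.lowerCentralSeries (⊤ : Subgroup G) k) : G) ∉
              Subgroup.lowerCentralSeries (⊤ : Subgroup G) (k + 1) := by simpa using hg'
          rcases o.1.one_lt_or_one_lt_inv (a := (g : G)) (fun h => hg' (h ▸ Subgroup.one_mem _))
            with h | h
          · exact .inl ((hP g hg').2 h)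
          · exact .inr ((hP g⁻¹ hginv).2 (by simpa using h))
      · rw [LeftOrdering.ofCone_one_lt, hP g hg]
    choose f hf using key
    exact ⟨f, hf⟩

theorem isClosed_BiO : IsClosed (BiO G) := by
  have : BiO G = ⋂ (a : G) (b : G) (c : G),
      (LeftOrdering.U a b)ᶜ ∪ LeftOrdering.U (a * c) (b * c) := by
    ext o
    simp only [BiO, LeftOrdering.U, Set.mem_ofPred_eq, Set.mem_iInter, Set.mem_union,
      Set.mem_compl_iff, ← imp_iff_not_or]
  rw [this]
  exact isClosed_iInter fun a => isClosed_iInter fun b => isClosed_iInter fun c =>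
    (LeftOrdering.isClopen_U _ _).compl.isClosed.union (LeftOrdering.isClopen_U _ _).isClosed

theorem isClosed_SBiO : IsClosed (SBiO G) := by
  have : SBiO G = ⋂ (k : ℕ) (g : G)
      (_ : g ∈ Subgroup.lowerCentralSeries (⊤ : Subgroup G) k)
      (_ : g ∉ Subgroup.lowerCentralSeries (⊤ : Subgroup G) (k + 1)) (h : G)
      (_ : h ∈ Subgroup.lowerCentralSeries (⊤ : Subgroup G) (k + 1)),
      (Subtype.val ⁻¹' ((LeftOrdering.U 1 g)ᶜ ∪ LeftOrdering.U 1 (g * h)) : Set (BiO G)) := by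
    ext o
    rw [mem_SBiO_iff]
    simp only [LeftOrdering.U, Set.mem_ofPred_eq, Set.mem_iInter, Set.mem_union,
      Set.mem_compl_iff, Set.mem_preimage, ← imp_iff_not_or]
  rw [this]
  refine isClosed_iInter fun k => isClosed_iInter fun g => isClosed_iInter fun _ =>
    isClosed_iInter fun _ => isClosed_iInter fun h => isClosed_iInter fun _ =>
    IsClosed.preimage continuous_subtype_val ?_
  exact (LeftOrdering.isClopen_U _ _).compl.isClosed.union (LeftOrdering.isClopen_U _ _).isClosed

/-! ### Changing the ordering of the abelianization. -/

theorem mem_BiO_iff_conj (o : LeftOrdering G) :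
    o ∈ BiO G ↔ ∀ g c, o.lt 1 g → o.lt 1 (c⁻¹ * g * c) := by
  refine ⟨fun h g c hg => ?_, fun h a b c hab => ?_⟩
  · simpa [mul_assoc] using o.mul_left _ _ c⁻¹ (h _ _ c hg)
  · rw [o.lt_iff_one_lt] at hab ⊢
    simpa [mul_assoc] using h _ c hab

/-- The lexicographic ordering that compares images under `φ` first. -/
def LeftOrdering.lex {Q : Type*} [Group Q] (o : LeftOrdering G) (φ : G →* Q)
    (q : LeftOrdering Q) : LeftOrdering G :=
  LeftOrdering.ofCone (fun g => q.lt 1 (φ g) ∨ (φ g = 1 ∧ o.lt 1 g))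
    (by
      rintro (h | h)
      · exact q.irrefl 1 (by simpa using h)
      · exact o.irrefl 1 h.2)
    (by
      rintro a b (ha | ha) (hb | hb)
      · exact .inl (by simpa using q.one_lt_mul ha hb)
      · exact .inl (by simpa [hb.1] using ha)
      · exact .inl (by simpa [ha.1] using hb)
      · exact .inr ⟨by simp [ha.1, hb.1], o.one_lt_mul ha.2 hb.2⟩)
    (by
      intro a ha
      by_cases h : φ a = 1
      · rcases o.one_lt_or_one_lt_inv ha with h' | h'
        · exact .inl (.inr ⟨h, h'⟩)
        · exact .inr (.inr ⟨by simp [h], h'⟩)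
      · rcases q.one_lt_or_one_lt_inv h with h' | h'
        · exact .inl (.inl h')
        · exact .inr (.inl (by simpa using h')))

theorem LeftOrdering.lex_one_lt {Q : Type*} [Group Q] (o : LeftOrdering G) (φ : G →* Q)
    (q : LeftOrdering Q) (g : G) :
    (o.lex φ q).lt 1 g ↔ q.lt 1 (φ g) ∨ (φ g = 1 ∧ o.lt 1 g) :=
  LeftOrdering.ofCone_one_lt g

theorem LeftOrdering.lex_one_lt_of_ne {Q : Type*} [Group Q] (o : LeftOrdering G) {φ : G →* Q}
    (q : LeftOrdering Q) {g : G} (hg : φ g ≠ 1) : (o.lex φ q).lt 1 g ↔ q.lt 1 (φ g) := by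
  simp [LeftOrdering.lex_one_lt, hg]

theorem LeftOrdering.lex_one_lt_of_eq {Q : Type*} [Group Q] (o : LeftOrdering G) {φ : G →* Q}
    (q : LeftOrdering Q) {g : G} (hg : φ g = 1) : (o.lex φ q).lt 1 g ↔ o.lt 1 g := by
  simp [LeftOrdering.lex_one_lt, hg, q.irrefl]

/-- Conjugation does not change the image in an abelian group, and on the kernel of `φ` the
bi-invariance of `o` applies. -/
theorem LeftOrdering.lex_mem_BiO {Q : Type*} [CommGroup Q] {o : LeftOrdering G} (ho : o ∈ BiO G)
    (φ : G →* Q) (q : LeftOrdering Q) : o.lex φ q ∈ BiO G := by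
  rw [mem_BiO_iff_conj] at ho ⊢
  intro g c hg
  have hφ : φ (c⁻¹ * g * c) = φ g := by
    rw [map_mul, map_mul, map_inv, mul_right_comm, inv_mul_cancel, one_mul]
  rw [LeftOrdering.lex_one_lt] at hg ⊢
  rw [hφ]
  exact hg.imp_right fun h => ⟨h.1, ho _ _ h.2⟩

/-- The projection of `G` onto the first factor of its lower central series. -/
def toLCSFactorZero (G : Type*) [Group G] : G →* LCSFactor G 0 where
  toFun g := QuotientGroup.mk ⟨g, Subgroup.mem_top g⟩
  map_one' := rfl
  map_mul' _ _ := rfl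

theorem toLCSFactorZero_surjective : Function.Surjective (toLCSFactorZero G) := by
  intro q
  induction q using QuotientGroup.induction_on with
  | H g => exact ⟨g, rfl⟩

theorem toLCSFactorZero_eq_one_iff (g : G) :
    toLCSFactorZero G g = 1 ↔ g ∈ Subgroup.lowerCentralSeries (⊤ : Subgroup G) 1 := by
  refine (QuotientGroup.eq_one_iff _).trans ?_
  rw [Subgroup.mem_subgroupOf]

theorem LCSFactor_zero_mul_comm (a b : LCSFactor G 0) : a * b = b * a := by
  obtain ⟨a, rfl⟩ := toLCSFactorZero_surjective a
  obtain ⟨b, rfl⟩ := toLCSFactorZero_surjective b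
  have h := (toLCSFactorZero_eq_one_iff ⁅a, b⁆).2
    (Subgroup.commutator_mem_commutator (Subgroup.mem_top a) (Subgroup.mem_top b))
  rwa [map_commutatorElement, commutatorElement_eq_one_iff_mul_comm] at h

instance : CommGroup (LCSFactor G 0) where
  mul_comm := LCSFactor_zero_mul_comm

/-- A standard bi-ordering of a group whose abelianization is finitely generated and not cyclic is
not determined by finitely many positive elements. -/
theorem exists_ne_mem_SBiO [Group.FG (LCSFactor G 0)] (hcyc : ¬ IsCyclic (LCSFactor G 0))
    {o : BiO G} (ho : o ∈ SBiO G) (T : Finset G) (hT : ∀ g ∈ T, o.1.lt 1 g) :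
    ∃ o' ∈ SBiO G, o' ≠ o ∧ ∀ g ∈ T, o'.1.lt 1 g := by
  classical
  obtain ⟨f, hf⟩ := id ho
  have hf0 : ∀ g, toLCSFactorZero G g ≠ 1 →
      (o.1.lt 1 g ↔ (f 0).lt 1 (toLCSFactorZero G g)) := fun g hg =>
    hf 0 ⟨g, Subgroup.mem_top g⟩ fun h => hg ((toLCSFactorZero_eq_one_iff g).2 h)
  -- Elements of `T` with trivial image impose no condition on the new ordering: their sign is still
  -- read from `o`.
  let S := (T.image (toLCSFactorZero G)).erase 1
  have hS : ∀ x ∈ S, (f 0).lt 1 x := by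
    intro x hx
    obtain ⟨hx1, hx⟩ := Finset.mem_erase.1 hx
    obtain ⟨g, hg, rfl⟩ := Finset.mem_image.1 hx
    exact (hf0 g hx1).1 (hT g hg)
  obtain ⟨q, hqS, hq⟩ : ∃ q : LeftOrdering (LCSFactor G 0), (∀ x ∈ S, q.lt 1 x) ∧ q ≠ f 0 := by
    by_contra! hcon
    exact hcyc ((f 0).isCyclic_of_isolated S hS hcon)
  refine ⟨⟨o.1.lex (toLCSFactorZero G) q, LeftOrdering.lex_mem_BiO o.2 _ q⟩, ?_, ?_, ?_⟩
  · rw [mem_SBiO_iff] at ho ⊢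
    intro k g hg hg' h hh
    have hh1 : toLCSFactorZero G h = 1 := (toLCSFactorZero_eq_one_iff h).2
      (Subgroup.lowerCentralSeries_antitone (S := (⊤ : Subgroup G)) (by omega : 1 ≤ k + 1) hh)
    have hgh : toLCSFactorZero G (g * h) = toLCSFactorZero G g := by rw [map_mul, hh1, mul_one]
    simp only [LeftOrdering.lex_one_lt, hgh]
    exact Or.imp_right fun hpos => ⟨hpos.1, ho k g hg hg' h hh hpos.2⟩
  · intro heq
    refine hq (LeftOrdering.ext_one_lt fun x => ?_)
    obtain ⟨g, rfl⟩ := toLCSFactorZero_surjective x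
    by_cases hg : toLCSFactorZero G g = 1
    · simp only [hg, q.irrefl, (f 0).irrefl]
    · rw [← hf0 g hg, ← LeftOrdering.lex_one_lt_of_ne o.1 q hg]
      exact iff_of_eq (congrArg (fun u : BiO G => u.1.lt 1 g) heq)
  · intro g hg
    by_cases hg1 : toLCSFactorZero G g = 1
    · exact (LeftOrdering.lex_one_lt_of_eq _ _ hg1).2 (hT g hg)
    · exact (LeftOrdering.lex_one_lt_of_ne _ _ hg1).2
        (hqS _ (Finset.mem_erase.2 ⟨hg1, Finset.mem_image_of_mem _ hg⟩))

/-- By left invariance, a basic neighbourhood prescribes the positivity of finitely many elements,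
so `exists_ne_mem_SBiO` supplies a second point. -/
theorem nontrivial_of_isOpen_SBiO [Group.FG (LCSFactor G 0)] (hcyc : ¬ IsCyclic (LCSFactor G 0))
    (V : Set (SBiO G)) (hV : IsOpen V) (hne : V.Nonempty) : V.Nontrivial := by
  classical
  obtain ⟨x, hx⟩ := hne
  obtain ⟨V', hV', rfl⟩ := isOpen_induced_iff.1 hV
  obtain ⟨W, hW, rfl⟩ := isOpen_induced_iff.1 hV'
  obtain ⟨_, ⟨F, ⟨hFfin, hF⟩, rfl⟩, hxF, hFW⟩ :=
    (TopologicalSpace.isTopologicalBasis_of_subbasis rfl).exists_subset_of_mem_open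
      (show x.1.1 ∈ W from hx) hW
  have key : ∀ s ∈ F, ∃ g : G, s = LeftOrdering.U 1 g := by
    intro s hs
    obtain ⟨a, b, rfl⟩ := hF hs
    exact ⟨a⁻¹ * b, Set.ext fun o => o.lt_iff_one_lt a b⟩
  choose! g hg using key
  obtain ⟨o', ho', hne, hpos⟩ := exists_ne_mem_SBiO hcyc x.2 (hFfin.toFinset.image g) (by
    intro y hy
    obtain ⟨s, hs, rfl⟩ := Finset.mem_image.1 hy
    have hs := hFfin.mem_toFinset.1 hs
    have := hxF s hs
    rw [hg s hs] at this
    exact this)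
  refine ⟨x, hx, ⟨o', ho'⟩, hFW fun s hs => ?_, fun h => hne (congrArg Subtype.val h).symm⟩
  rw [hg s hs]
  exact hpos _ (Finset.mem_image_of_mem _ (hFfin.mem_toFinset.2 hs))

/-! ### Cyclic abelianization and the conclusion. -/

/-- A residually nilpotent group with cyclic abelianization is cyclic. -/
theorem isCyclic_of_isCyclic_LCSFactor_zero
    (hG : (⨅ k : ℕ, Subgroup.lowerCentralSeries (⊤ : Subgroup G) k) = ⊥)
    [IsCyclic (LCSFactor G 0)] : IsCyclic G := by
  have hle : Subgroup.lowerCentralSeries (⊤ : Subgroup G) 1 ≤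
      Subgroup.lowerCentralSeries (⊤ : Subgroup G) 2 := by
    let N := Subgroup.lowerCentralSeries (⊤ : Subgroup G) 2
    let φ : G ⧸ N →* LCSFactor G 0 := QuotientGroup.lift N (toLCSFactorZero G) fun g hg =>
      (toLCSFactorZero_eq_one_iff g).2
        (Subgroup.lowerCentralSeries_antitone (S := (⊤ : Subgroup G)) one_le_two hg)
    -- The kernel is G^1/G^2, central because [G^1, G] = G^2. A central extension of a cyclic group
    -- is abelian, so G^1 ≤ G^2; the lower central series is then constant from G^1 on, hence
    -- trivial there.
    have hφ : φ.ker ≤ Subgroup.center (G ⧸ N) := by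
      intro x hx
      induction x using QuotientGroup.induction_on with
      | H g =>
        have hg : g ∈ Subgroup.lowerCentralSeries (⊤ : Subgroup G) 1 :=
          (toLCSFactorZero_eq_one_iff g).1 hx
        refine Subgroup.mem_center_iff.2 fun y => ?_
        induction y using QuotientGroup.induction_on with
        | H h =>
          have hmem : ⁅g, h⁆ ∈ N :=
            Subgroup.commutator_mem_commutator hg (Subgroup.mem_top h)
          have := (QuotientGroup.eq_one_iff _).2 hmem
          exact (commutatorElement_eq_one_iff_mul_comm.1
            ((map_commutatorElement (QuotientGroup.mk' N) g h).symm.trans this)).symm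
    refine Subgroup.commutator_le.2 fun a _ b _ => ?_
    refine (QuotientGroup.eq_one_iff (N := N) _).1 ?_
    refine (map_commutatorElement (QuotientGroup.mk' N) a b).trans
      (commutatorElement_eq_one_iff_mul_comm.2 ?_)
    exact (MonoidHom.isMulCommutative_of_isCyclic_of_ker_le_center φ hφ).is_comm.comm _ _
  have hall : ∀ k, Subgroup.lowerCentralSeries (⊤ : Subgroup G) 1 ≤
      Subgroup.lowerCentralSeries (⊤ : Subgroup G) k := by
    intro k
    induction k with
    | zero => exact le_top
    | succ k ih => exact hle.trans (Subgroup.commutator_mono ih le_rfl)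
  have hbot : Subgroup.lowerCentralSeries (⊤ : Subgroup G) 1 = ⊥ :=
    le_bot_iff.1 (hG ▸ le_iInf hall)
  refine isCyclic_of_injective (toLCSFactorZero G) ((injective_iff_map_eq_one _).2 fun g hg => ?_)
  rwa [toLCSFactorZero_eq_one_iff, hbot, Subgroup.mem_bot] at hg

theorem LeftOrdering.infinite [Nontrivial G] (o : LeftOrdering G) : Infinite G := by
  obtain ⟨g, hg⟩ := exists_ne (1 : G)
  refine not_finite_iff_infinite.1 fun _ => hg ?_
  exact o.eq_one_of_pow_eq_one (orderOf_pos g).ne' (pow_orderOf_eq_one g)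

theorem nonempty_homeomorph_cantorSet_SBiO [Countable G] [Group.FG (LCSFactor G 0)]
    (hcyc : ¬ IsCyclic (LCSFactor G 0)) (hne : (SBiO G).Nonempty) :
    Nonempty (SBiO G ≃ₜ cantorSet) := by
  have : CompactSpace (BiO G) := isCompact_iff_compactSpace.1 isClosed_BiO.isCompact
  have : CompactSpace (SBiO G) := isCompact_iff_compactSpace.1 isClosed_SBiO.isCompact
  have : Nonempty (SBiO G) := hne.to_subtype
  obtain ⟨e, he⟩ := exists_surjective_nat G
  obtain ⟨φ⟩ := nonempty_homeomorph_nat_bool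
    (fun n => {o : SBiO G | o.1.1 ∈ LeftOrdering.U 1 (e n)})
    (fun n => (LeftOrdering.isClopen_U 1 (e n)).preimage
      (continuous_subtype_val.comp continuous_subtype_val))
    (fun x y h => Subtype.ext (Subtype.ext (LeftOrdering.ext_one_lt fun a => by
      obtain ⟨n, rfl⟩ := he a
      exact h n)))
    (nontrivial_of_isOpen_SBiO hcyc)
  exact ⟨φ.trans cantorSetHomeomorphNatToBool.symm⟩

end Standard

theorem mainTheorem7 (G : Type*) [Group G] [Countable G]
    (hG : (⨅ k : ℕ, Subgroup.lowerCentralSeries (⊤ : Subgroup G) k) = ⊥) :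
    IsClosed (SBiO G) ∧
    (Nontrivial G → IsEmpty (G ≃* Multiplicative ℤ) → (∀ k : ℕ, Group.FG (LCSFactor G k)) →
      SBiO G = ∅ ∨ Nonempty (SBiO G ≃ₜ cantorSet)) := by
  refine ⟨isClosed_SBiO, fun _ hZ hfg => ?_⟩
  refine (SBiO G).eq_empty_or_nonempty.imp_right fun hne => ?_
  have := hfg 0
  refine nonempty_homeomorph_cantorSet_SBiO (fun _ => ?_) hne
  have : Infinite G := hne.some.1.infinite
  have : IsCyclic G := isCyclic_of_isCyclic_LCSFactor_zero hG
  exact hZ.false intCyclicMulEquiv.symm
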